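/- Let $f,g\in L^2([0,1])$ be real-valued and set $\Delta=\|f-g\|_{L^2([0,1])}$, with $\Delta>0$. Let $Y$ be a Bernoulli random variable with parameter $1/2$, let $W=(W(t))_{0\le t\le 1}$ be a standard Brownian motion independent of $Y$, and let $X=(X(t))_{0\le t\le1}$ be the process with $X(0)=0$ and $$dX(t)=Y f(t)\,dt+(1-Y)\,g(t)\,dt+dW(t),\qquad t\in[0,1].$$ Let $\eta(X)=\mathbb E[Y\mid X]=\mathbb P(Y=1\mid X)$ be the regression function, the conditioning being on the whole trajectory $(X(t))_{0\le t\le 1}$. Set $$\delta=\frac{e^{-(1+\Delta/2)^2/2}}{2\sqrt{2\pi}}.$$ Then, for all $\epsilon\le \min(1/4,\Delta)$, $$\mathbb P\left(\delta\epsilon\le\left|\eta(X)-\tfrac12\right|\le\epsilon\right)\ \ge\ \delta\,\frac{\epsilon}{\Delta}.$$ -/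

import Mathlib

open MeasureTheory ProbabilityTheory
open scoped unitInterval

/-- A standard Brownian motion on `[0,1]`: a centred Gaussian process with covariance
`min s t` whose paths are almost surely continuous. -/
structure IsBrownianOnUnitInterval {Ω : Type*} [MeasurableSpace Ω]
    (W : I → Ω → ℝ) (P : Measure Ω) : Prop where
  measurable : ∀ t, Measurable (W t)
  isGaussianProcess : IsGaussianProcess W P
  integral_eq_zero : ∀ t, ∫ ω, W t ω ∂P = 0
  covariance_eq : ∀ s t : I, cov[W s, W t; P] = min (s : ℝ) (t : ℝ)
  continuous_paths : ∀ᵐ ω ∂P, Continuous fun t => W t ω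

/-- The functional classification model: `Y` is a Bernoulli variable of parameter `1/2`,
independent of the standard Brownian motion `W` on `[0,1]`, and `X` is a process started at `0`
with `dX(t) = Y f(t) dt + (1 - Y) g(t) dt + dW(t)` on `[0,1]`, in integrated form. -/
structure IsFunctionalModel {Ω : Type*} [MeasurableSpace Ω]
    (f g : ℝ → ℝ) (X : I → Ω → ℝ) (Y : Ω → ℝ) (W : I → Ω → ℝ) (P : Measure Ω) : Prop where
  measurable_input : ∀ t, Measurable (X t)
  measurable_label : Measurable Y
  brownian : IsBrownianOnUnitInterval W P
  label_law : HasLaw Y (bernoulliMeasure (1 : ℝ) 0 ⟨1 / 2, by norm_num, by norm_num⟩) P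
  indep : IndepFun Y (fun ω t => W t ω) P
  solution : ∀ᵐ ω ∂P, ∀ t : I,
    X t ω = Y ω * (∫ s in (0 : ℝ)..t, f s) + (1 - Y ω) * (∫ s in (0 : ℝ)..t, g s) + W t ω

/-- The regression function evaluated at the input, `η(X) = E[Y | X] = P(Y = 1 | X)`: the
conditional expectation of the label given the sigma-algebra generated by the whole
trajectory `(X(t))`, `t ∈ [0,1]`. -/
noncomputable def etaX {Ω : Type*} [MeasurableSpace Ω]
    (X : I → Ω → ℝ) (Y : Ω → ℝ) (P : Measure Ω) : Ω → ℝ :=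
  P[Y | MeasurableSpace.comap (fun ω t => X t ω) MeasurableSpace.pi]

/-- The distance `‖f - g‖` in `L²([0,1])`. -/
noncomputable def l2Dist (f g : ℝ → ℝ) : ℝ :=
  Real.sqrt (∫ t in (0 : ℝ)..1, (f t - g t) ^ 2)

/-- The constant `e^{-(1 + Δ/2)² / 2} / (2 √(2π))`. -/
noncomputable def crownConst (Δ : ℝ) : ℝ :=
  Real.exp (-(1 + Δ / 2) ^ 2 / 2) / (2 * Real.sqrt (2 * Real.pi))

/-! With `k = f - g`, let `ξ` be the Wiener integral of `k`, of variance `v = Δ²`. Projecting `W` on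
`ξ` leaves a residual `R` independent of `ξ` (`indepFun_residual`), and the drift of `X` is
proportional to the same projection coefficients, so `X` is a function of `R` and `U = ξ + Y v`
alone. Conversely `U` is recovered from `X`. Since `(R, ξ)` is independent of `Y`, only `U` informs
on `Y`: Bayes' formula for the Gaussians of means `v` and `0` gives `η(X) = sigmoid (U - v/2)`
almost surely (`condExp_label_eq_sigmoid`, `etaX_ae_eq_sigmoid`).

For `|x| ≤ 1/4`, `|sigmoid x - 1/2|` lies between `|x|/5` and `|x|/2`, so it suffices that `5δε ≤ |U
- v/2| ≤ ε`. Given `Y`, `U - v/2` is Gaussian with mean `±Δ²/2` and variance `Δ²`. Its density is at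
least `2δ/Δ` on this set, whose length `2(1 - 5δ)ε` is at least `ε/2` because `δ ≤ 3/20`
(`crownConst_mul_le_gaussianReal`). -/

open Filter Topology in
/-- Almost sure limits of centred Gaussian variables with convergent variances are Gaussian. -/
lemma map_eq_gaussianReal_of_tendsto_ae {Ω : Type*} [MeasurableSpace Ω] {P : Measure Ω}
    [IsProbabilityMeasure P] {Z : ℕ → Ω → ℝ} {ξ : Ω → ℝ} {v : ℕ → NNReal} {w : NNReal}
    (hZ : ∀ n, AEMeasurable (Z n) P) (hlaw : ∀ n, P.map (Z n) = gaussianReal 0 (v n))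
    (hlim : ∀ᵐ ω ∂P, Tendsto (fun n => Z n ω) atTop (𝓝 (ξ ω)))
    (hv : Tendsto v atTop (𝓝 w)) : P.map ξ = gaussianReal 0 w := by
  have hξ : AEMeasurable ξ P := aemeasurable_of_tendsto_metrizable_ae atTop hZ hlim
  have := Measure.isProbabilityMeasure_map hξ
  refine Measure.ext_of_charFun (funext fun t => ?_)
  have h1 : Tendsto (fun n => charFun (P.map (Z n)) t) atTop (𝓝 (charFun (P.map ξ) t)) := by
    simp_rw [charFun_apply_real]
    rw [integral_map hξ (by fun_prop)]
    simp_rw [fun n => integral_map (hZ n)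
      (f := fun x : ℝ => Complex.exp (t * x * Complex.I)) (by fun_prop)]
    refine tendsto_integral_of_dominated_convergence (fun _ => (1 : ℝ))
      (fun n => ?_) (integrable_const _) (fun n => ?_) ?_
    · have := hZ n
      exact AEMeasurable.aestronglyMeasurable (by fun_prop)
    · refine ae_of_all _ fun ω => ?_
      rw [← Complex.ofReal_mul, Complex.norm_exp_ofReal_mul_I]
    · filter_upwards [hlim] with ω hω
      have hc : Continuous fun x : ℝ => Complex.exp (t * x * Complex.I) := by fun_prop
      exact (hc.tendsto _).comp hω
  refine tendsto_nhds_unique h1 ?_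
  simp_rw [hlaw, charFun_gaussianReal]
  have hc : Continuous fun x : NNReal =>
      Complex.exp (t * (0 : ℝ) * Complex.I - (x : ℝ) * t ^ 2 / 2) := by fun_prop
  exact (hc.tendsto w).comp hv

/-- The norm of a combination depends only on the Gram matrix; this turns the Brownian covariance
into the Itô isometry. -/
lemma norm_linearCombination_eq_of_inner_eq {ι E F : Type*} [NormedAddCommGroup E]
    [InnerProductSpace ℝ E] [NormedAddCommGroup F] [InnerProductSpace ℝ F] {u : ι → E} {v : ι → F}
    (h : ∀ s t, inner ℝ (u s) (u t) = inner ℝ (v s) (v t)) (a : ι →₀ ℝ) :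
    ‖Finsupp.linearCombination ℝ u a‖ = ‖Finsupp.linearCombination ℝ v a‖ := by
  rw [norm_eq_sqrt_real_inner, norm_eq_sqrt_real_inner]
  simp only [Finsupp.linearCombination_apply, Finsupp.sum, sum_inner, inner_sum, inner_smul_left,
    inner_smul_right, h]

/-! ### Step functions in `L²([0,1])` -/

/-- The indicator of `[0,t]` as an element of `L²([0,1])`. -/
noncomputable def stepLp (t : I) : Lp ℝ 2 (volume.restrict (Set.Icc (0 : ℝ) 1)) :=
  indicatorConstLp 2 (measurableSet_Iic (a := (t : ℝ))) (measure_ne_top _ _) 1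

lemma setIntegral_Iic_restrict_Icc (k : ℝ → ℝ) (t : I) :
    ∫ x in Set.Iic (t : ℝ), k x ∂(volume.restrict (Set.Icc (0 : ℝ) 1)) =
      ∫ x in (0 : ℝ)..t, k x := by
  rw [Measure.restrict_restrict measurableSet_Iic, intervalIntegral.integral_of_le t.2.1,
    ← integral_Icc_eq_integral_Ioc]
  congr 2
  ext x
  have := t.2.2
  simp only [Set.mem_inter_iff, Set.mem_Iic, Set.mem_Icc]
  constructor <;> intro h <;> refine ⟨?_, ?_⟩ <;> grind

lemma inner_stepLp (t : I) (k : Lp ℝ 2 (volume.restrict (Set.Icc (0 : ℝ) 1))) :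
    inner ℝ (stepLp t) k = ∫ x in (0 : ℝ)..t, k x := by
  rw [stepLp, L2.inner_indicatorConstLp_one, setIntegral_Iic_restrict_Icc]

lemma inner_stepLp_stepLp (s t : I) : inner ℝ (stepLp s) (stepLp t) = min (s : ℝ) t := by
  rw [stepLp, stepLp, L2.inner_indicatorConstLp_one,
    setIntegral_congr_ae (g := (Set.Iic (t : ℝ)).indicator fun _ => (1 : ℝ)) measurableSet_Iic]
  · rw [setIntegral_Iic_restrict_Icc, intervalIntegral.integral_of_le s.2.1,
      setIntegral_indicator measurableSet_Iic, Set.Ioc_inter_Iic]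
    simp [s.2.1, t.2.1]
  · filter_upwards [indicatorConstLp_coeFn (p := 2) (hs := measurableSet_Iic (a := (t : ℝ)))
      (hμs := measure_ne_top (volume.restrict (Set.Icc (0 : ℝ) 1)) _) (c := (1 : ℝ))] with x hx _
    exact hx

/-- A function orthogonal to every `stepLp t` has zero integral on each half-line, hence on all
Borel sets by a π-λ argument, hence vanishes. -/
lemma topologicalClosure_span_stepLp :
    (Submodule.span ℝ (Set.range stepLp)).topologicalClosure = ⊤ := by
  rw [Submodule.topologicalClosure_eq_top_iff, Submodule.eq_bot_iff]
  intro k hk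
  have h0 : ∀ t : I, ∫ x in Set.Iic (t : ℝ), k x ∂(volume.restrict (Set.Icc (0 : ℝ) 1)) = 0 := by
    intro t
    rw [setIntegral_Iic_restrict_Icc, ← inner_stepLp]
    exact Submodule.inner_right_of_mem_orthogonal 
      (Submodule.subset_span (Set.mem_range_self t)) hk
  have hint : Integrable k (volume.restrict (Set.Icc (0 : ℝ) 1)) :=
    (Lp.memLp k).integrable (by norm_num)
  have hmem : ∀ᵐ x ∂(volume.restrict (Set.Icc (0 : ℝ) 1)), x ∈ Set.Icc (0 : ℝ) 1 :=
    ae_restrict_mem measurableSet_Icc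
  have huniv : ∫ x, k x ∂(volume.restrict (Set.Icc (0 : ℝ) 1)) = 0 := by
    refine (setIntegral_eq_integral_of_ae_compl_eq_zero ?_).symm.trans (h0 1)
    filter_upwards [hmem] with x hx hx'
    exact absurd hx.2 (by simpa using hx')
  have hIic : ∀ a : ℝ, ∫ x in Set.Iic a, k x ∂(volume.restrict (Set.Icc (0 : ℝ) 1)) = 0 := by
    intro a
    rcases lt_or_ge a 0 with ha | ha
    · refine setIntegral_eq_zero_of_ae_eq_zero ?_
      filter_upwards [hmem] with x hx hxa
      exact absurd (hx.1.trans hxa) (not_le.2 ha)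
    rcases le_or_gt a 1 with ha' | ha'
    · exact h0 ⟨a, ha, ha'⟩
    · rw [setIntegral_eq_integral_of_ae_compl_eq_zero, huniv]
      filter_upwards [hmem] with x hx hx'
      exact absurd (hx.2.trans ha'.le) (by simpa using hx')
  have hall : ∀ s, MeasurableSet s →
      ∫ x in s, k x ∂(volume.restrict (Set.Icc (0 : ℝ) 1)) = 0 := by
    intro s hs
    induction s, hs using MeasurableSpace.induction_on_inter (borel_eq_generateFrom_Iic ℝ ▸
      (BorelSpace.measurable_eq (α := ℝ))) (isPiSystem_Iic (α := ℝ)) with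
    | empty => simp
    | basic s hs => obtain ⟨a, rfl⟩ := hs; exact hIic a
    | compl s hs ih =>
      have := integral_add_compl hs hint
      rw [ih, huniv] at this
      linarith
    | iUnion g hd hm ih => simp [integral_iUnion hm hd hint.integrableOn, ih]
  refine (Lp.eq_zero_iff_ae_eq_zero).2 ?_
  exact hint.ae_eq_zero_of_forall_setIntegral_eq_zero fun s hs _ => hall s hs

-- The limsup is measurable for the σ-algebra of the `Z n` itself, with no completion. It is used
-- with the σ-algebras generated by `W` and by `X`.
open Filter Topology in
lemma exists_measurable_forall_tendsto_eq {Ω : Type*} {m : MeasurableSpace Ω} {Z : ℕ → Ω → ℝ}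
    (hZ : ∀ n, Measurable (Z n)) :
    ∃ ξ : Ω → ℝ, Measurable ξ ∧ ∀ ω l, Tendsto (fun n => Z n ω) atTop (𝓝 l) → l = ξ ω :=
  ⟨fun ω => limsup (fun n => Z n ω) atTop, Measurable.limsup hZ, fun _ _ h => h.limsup_eq.symm⟩

/-! ### The Wiener integral -/

section WienerIntegral

variable {Ω : Type*}

/-- Finite linear combinations of the values of a process. -/
noncomputable def processComb (W : I → Ω → ℝ) : (I →₀ ℝ) →ₗ[ℝ] (Ω → ℝ) :=
  Finsupp.linearCombination ℝ W

/-- Step functions on `[0,1]` as elements of `L²([0,1])`. -/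
noncomputable def stepComb : (I →₀ ℝ) →ₗ[ℝ] Lp ℝ 2 (volume.restrict (Set.Icc (0 : ℝ) 1)) :=
  Finsupp.linearCombination ℝ stepLp

lemma processComb_apply (W : I → Ω → ℝ) (a : I →₀ ℝ) (ω : Ω) :
    processComb W a ω = ∑ t ∈ a.support, a t * W t ω := by
  simp [processComb, Finsupp.linearCombination_apply, Finsupp.sum]

lemma measurable_processComb {m : MeasurableSpace Ω} (hW : ∀ t, Measurable[m] (W t))
    (a : I →₀ ℝ) : Measurable[m] (processComb W a) := by
  have : processComb W a = fun ω => ∑ t ∈ a.support, a t * W t ω :=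
    funext (processComb_apply W a)
  rw [this]
  exact Finset.measurable_sum _ fun t _ => (hW t).const_mul _

variable [MeasurableSpace Ω] {W : I → Ω → ℝ} {P : Measure Ω}

lemma IsBrownianOnUnitInterval.memLp (hW : IsBrownianOnUnitInterval W P) (t : I) :
    MemLp (W t) 2 P :=
  (hW.isGaussianProcess.hasGaussianLaw_eval t).memLp_two

lemma IsBrownianOnUnitInterval.integral_mul (hW : IsBrownianOnUnitInterval W P) (s t : I) :
    ∫ ω, W s ω * W t ω ∂P = min (s : ℝ) t := by
  have := hW.isGaussianProcess.isProbabilityMeasure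
  rw [← hW.covariance_eq s t, covariance_eq_sub (hW.memLp s) (hW.memLp t)]
  simp [hW.integral_eq_zero]

lemma IsBrownianOnUnitInterval.coeFn_linearCombination (hW : IsBrownianOnUnitInterval W P)
    (a : I →₀ ℝ) :
    Finsupp.linearCombination ℝ (fun t => (hW.memLp t).toLp) a =ᵐ[P] processComb W a := by
  induction a using Finsupp.induction_linear with
  | zero => simpa using Lp.coeFn_zero ℝ 2 P
  | add a b ha hb =>
    rw [map_add, map_add]
    exact (Lp.coeFn_add _ _).trans (ha.add hb)
  | single t c =>
    rw [processComb, Finsupp.linearCombination_single, Finsupp.linearCombination_single]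
    exact (Lp.coeFn_smul _ _).trans ((hW.memLp t).coeFn_toLp.const_smul c)

/-- The Itô isometry on step functions: `min s t` is also the inner product of the indicators of
`[0,s]` and `[0,t]`. -/
lemma IsBrownianOnUnitInterval.norm_linearCombination (hW : IsBrownianOnUnitInterval W P)
    (a : I →₀ ℝ) :
    ‖Finsupp.linearCombination ℝ (fun t => (hW.memLp t).toLp) a‖ = ‖stepComb a‖ := by
  refine norm_linearCombination_eq_of_inner_eq (fun s t => ?_) a
  rw [inner_stepLp_stepLp, ← hW.integral_mul, L2.inner_def]
  refine integral_congr_ae ?_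
  filter_upwards [(hW.memLp s).coeFn_toLp, (hW.memLp t).coeFn_toLp] with ω h1 h2
  simp [h1, h2, mul_comm]

lemma IsBrownianOnUnitInterval.map_processComb (hW : IsBrownianOnUnitInterval W P)
    (a : I →₀ ℝ) : P.map (processComb W a) = gaussianReal 0 (‖stepComb a‖₊ ^ 2) := by
  have := hW.isGaussianProcess.isProbabilityMeasure
  have hG : HasGaussianLaw (processComb W a) P := by
    have h1 : HasGaussianLaw (∑ t ∈ a.support, fun ω => a t • W t ω) P :=
      (hW.isGaussianProcess.smul a).hasGaussianLaw_sum
    convert h1 using 1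
    ext ω
    simp [processComb_apply]
  have hint : ∫ ω, processComb W a ω ∂P = 0 := by
    simp_rw [processComb_apply]
    rw [integral_finsetSum _ fun t _ => ((hW.memLp t).integrable (by norm_num)).const_mul _]
    simp [integral_const_mul, hW.integral_eq_zero]
  rw [hG.map_eq_gaussianReal, hint, variance_of_integral_eq_zero hG.aemeasurable hint]
  congr 1
  ext
  rw [Real.coe_toNNReal _ (integral_nonneg fun _ => sq_nonneg _)]
  push_cast
  rw [← hW.norm_linearCombination a, ← real_inner_self_eq_norm_sq, L2.inner_def]
  refine integral_congr_ae ?_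
  filter_upwards [hW.coeFn_linearCombination a] with ω h1
  simp [h1, sq]

open Filter Topology in
/-- The Wiener integral of `k ∈ L²([0,1])`, obtained as an almost sure limit of Wiener integrals
of step functions converging to `k`. -/
lemma IsBrownianOnUnitInterval.exists_wienerIntegral (hW : IsBrownianOnUnitInterval W P)
    (k : Lp ℝ 2 (volume.restrict (Set.Icc (0 : ℝ) 1))) :
    ∃ (c : ℕ → I →₀ ℝ) (ξ : Ω → ℝ),
      Measurable[MeasurableSpace.comap (fun ω t => W t ω) MeasurableSpace.pi] ξ ∧
      Tendsto (fun n => stepComb (c n)) atTop (𝓝 k) ∧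
      (∀ᵐ ω ∂P, Tendsto (fun n => processComb W (c n) ω) atTop (𝓝 (ξ ω))) ∧
      ∀ (a : I →₀ ℝ) (b : ℝ), P.map (processComb W a + b • ξ) =
        gaussianReal 0 (‖stepComb a + b • k‖₊ ^ 2) := by
  have := hW.isGaussianProcess.isProbabilityMeasure
  have hk : k ∈ closure (Set.range stepComb) := by
    have h1 : k ∈ (Submodule.span ℝ (Set.range stepLp)).topologicalClosure := by
      rw [topologicalClosure_span_stepLp]; trivial
    rw [← Finsupp.range_linearCombination] at h1
    exact h1
  obtain ⟨x, hx, hxk⟩ := mem_closure_iff_seq_limit.1 hk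
  choose c hc using hx
  obtain rfl : (fun n => stepComb (c n)) = x := funext hc
  set S := Finsupp.linearCombination ℝ (fun t => (hW.memLp t).toLp) with hS
  have hcauchy : CauchySeq fun n => S (c n) := by
    refine Metric.cauchySeq_iff'.2 fun ε hε => ?_
    obtain ⟨N, hN⟩ := Metric.cauchySeq_iff'.1 hxk.cauchySeq ε hε
    refine ⟨N, fun n hn => ?_⟩
    rw [dist_eq_norm, ← map_sub, hS, hW.norm_linearCombination, map_sub, ← dist_eq_norm]
    exact hN n hn
  obtain ⟨z, hz⟩ := cauchySeq_tendsto_of_complete hcauchy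
  -- `L²` convergence gives almost sure convergence only along a subsequence, which still
  -- approximates `k`.
  obtain ⟨φ, hφ, hφz⟩ := (tendstoInMeasure_of_tendsto_Lp hz).exists_seq_tendsto_ae
  have hz' : ∀ᵐ ω ∂P, Tendsto (fun n => processComb W (c (φ n)) ω) atTop (𝓝 (z ω)) := by
    filter_upwards [hφz, ae_all_iff.2 fun n => hW.coeFn_linearCombination (c (φ n))] with ω h1 h2
    simpa only [← h2] using h1
  obtain ⟨ξ, hξm, hξ⟩ := exists_measurable_forall_tendsto_eq
    (m := MeasurableSpace.comap (fun ω t => W t ω) MeasurableSpace.pi)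
    fun n => measurable_processComb
      (fun t => (measurable_pi_apply t).comp (comap_measurable _)) (c (φ n))
  have hlim : ∀ᵐ ω ∂P, Tendsto (fun n => processComb W (c (φ n)) ω) atTop (𝓝 (ξ ω)) := by
    filter_upwards [hz'] with ω h1
    rwa [← hξ ω _ h1]
  have hcφ := hxk.comp hφ.tendsto_atTop
  refine ⟨fun n => c (φ n), ξ, hξm, hcφ, hlim,
    fun a b => ?_⟩
  refine map_eq_gaussianReal_of_tendsto_ae (Z := fun n => processComb W (a + b • c (φ n)))
    (fun n => (measurable_processComb hW.measurable _).aemeasurable)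
    (fun n => hW.map_processComb _) ?_ ?_
  · filter_upwards [hlim] with ω h1
    simpa using (h1.const_mul b).const_add (processComb W a ω)
  · simp only [map_add, map_smul]
    exact (((hcφ.const_smul b).const_add (stepComb a)).nnnorm).pow 2

end WienerIntegral

/-! ### Splitting the Brownian path along its Wiener integral -/

section Decomposition

variable {Ω : Type*} [MeasurableSpace Ω] {W : I → Ω → ℝ} {P : Measure Ω} {ξ : Ω → ℝ}
  {k : Lp ℝ 2 (volume.restrict (Set.Icc (0 : ℝ) 1))}

/-- Variables which are combinations of `W` and its Wiener integral form a Gaussian process. -/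
lemma isGaussianProcess_of_eq_processComb_add [IsProbabilityMeasure P]
    (hW : ∀ t, Measurable (W t)) (hξ : Measurable ξ)
    (hlaw : ∀ (a : I →₀ ℝ) (b : ℝ), P.map (processComb W a + b • ξ) =
      gaussianReal 0 (‖stepComb a + b • k‖₊ ^ 2))
    {T : Type*} {Z : T → Ω → ℝ} (a : T → I →₀ ℝ) (b : T → ℝ)
    (hZ : ∀ i, Z i = processComb W (a i) + b i • ξ) : IsGaussianProcess Z P where
  hasGaussianLaw J := by
    have hZm : ∀ i, Measurable (Z i) := fun i => by
      rw [hZ]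
      exact (measurable_processComb hW _).add (hξ.const_smul _)
    have hJ : Measurable fun ω => J.restrict (Z · ω) :=
      measurable_pi_lambda _ fun i => hZm i
    refine ⟨isGaussian_of_map_eq_gaussianReal fun L => ?_⟩
    classical
    -- A linear functional of finitely many `Z i` is again of the form covered by `hlaw`, so
    -- one-dimensional laws suffice for joint Gaussianity.
    have hL : (L ∘ fun ω => J.restrict (Z · ω)) =
        processComb W (∑ i : J, L (Pi.single i 1) • a i) +
          (∑ i : J, L (Pi.single i 1) * b i) • ξ := by
      ext ω
      simp only [Function.comp_apply, map_sum, map_smul, Pi.add_apply, Finset.sum_apply,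
        Pi.smul_apply, smul_eq_mul, Finset.sum_mul, ← Finset.sum_add_distrib]
      conv_lhs => rw [← Finset.univ_sum_single (J.restrict (Z · ω)), map_sum]
      refine Finset.sum_congr rfl fun i _ => ?_
      have : Pi.single i (J.restrict (Z · ω) i) =
          Z i ω • (Pi.single i 1 : J → ℝ) := by
        rw [← Pi.single_smul]; simp
      rw [this, map_smul, hZ]
      simp
      ring
    rw [Measure.map_map L.continuous.measurable hJ, hL, hlaw]
    exact ⟨_, _, rfl⟩

/-- Polarization of the variances read off from `hlaw`. -/
lemma covariance_processComb_add [IsProbabilityMeasure P]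
    (hW : ∀ t, Measurable (W t)) (hξ : Measurable ξ)
    (hlaw : ∀ (a : I →₀ ℝ) (b : ℝ), P.map (processComb W a + b • ξ) =
      gaussianReal 0 (‖stepComb a + b • k‖₊ ^ 2)) (a a' : I →₀ ℝ) (b b' : ℝ) :
    cov[processComb W a + b • ξ, processComb W a' + b' • ξ; P] =
      inner ℝ (stepComb a + b • k) (stepComb a' + b' • k) := by
  have hm : ∀ (a : I →₀ ℝ) (b : ℝ), AEMeasurable (processComb W a + b • ξ) P := fun a b =>
    ((measurable_processComb hW a).add (hξ.const_smul b)).aemeasurable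
  have hL2 : ∀ (a : I →₀ ℝ) (b : ℝ), MemLp (processComb W a + b • ξ) 2 P := fun a b =>
    HasGaussianLaw.memLp_two ⟨by rw [hlaw]; infer_instance⟩
  have hvar : ∀ (a : I →₀ ℝ) (b : ℝ), Var[processComb W a + b • ξ; P] =
      ‖stepComb a + b • k‖ ^ 2 := fun a b => by
    rw [← variance_id_map (hm a b), hlaw, variance_id_gaussianReal]
    simp
  have h1 := variance_add (hL2 a b) (hL2 a' b')
  have h2 : processComb W a + b • ξ + (processComb W a' + b' • ξ) =
      processComb W (a + a') + (b + b') • ξ := by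
    rw [map_add, add_smul]; abel
  have h3 : stepComb (a + a') + (b + b') • k =
      (stepComb a + b • k) + (stepComb a' + b' • k) := by
    rw [map_add, add_smul]; abel
  rw [h2, hvar, hvar, hvar, h3, norm_add_sq_real] at h1
  linarith

/-- The residual of `W` after projection on its Wiener integral `ξ` is independent of `ξ`. -/
lemma indepFun_residual [IsProbabilityMeasure P] (hk : k ≠ 0)
    (hW : ∀ t, Measurable (W t)) (hξ : Measurable ξ)
    (hlaw : ∀ (a : I →₀ ℝ) (b : ℝ), P.map (processComb W a + b • ξ) =
      gaussianReal 0 (‖stepComb a + b • k‖₊ ^ 2)) :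
    IndepFun (fun ω t => W t ω - inner ℝ (stepLp t) k / ‖k‖ ^ 2 * ξ ω) ξ P := by
  set R : I → Ω → ℝ := fun t ω => W t ω - inner ℝ (stepLp t) k / ‖k‖ ^ 2 * ξ ω with hR
  have hR' : ∀ t, R t = processComb W (Finsupp.single t 1) +
      (-(inner ℝ (stepLp t) k / ‖k‖ ^ 2)) • ξ := fun t => by
    ext ω
    simp [hR, processComb]
    ring
  have hξ' : ξ = processComb W 0 + (1 : ℝ) • ξ := by simp
  have hRm : ∀ t, Measurable (R t) := fun t => (hW t).sub (hξ.const_mul _)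
  have hG : IsGaussianProcess (Sum.elim R fun _ : Unit => ξ) P :=
    isGaussianProcess_of_eq_processComb_add hW hξ hlaw
      (Sum.elim (fun t => Finsupp.single t 1) fun _ => 0)
      (Sum.elim (fun t => -(inner ℝ (stepLp t) k / ‖k‖ ^ 2)) fun _ => 1)
      (by rintro (t | t); exacts [hR' t, hξ'])
  have h := hG.indepFun_of_covariance_eq_zero (fun t => (hRm t).aemeasurable)
    (fun _ => hξ.aemeasurable) fun t _ => by
      have hk' : ‖k‖ ^ 2 ≠ 0 := pow_ne_zero _ (norm_ne_zero_iff.2 hk)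
      have h := covariance_processComb_add hW hξ hlaw (Finsupp.single t 1) 0
        (-(inner ℝ (stepLp t) k / ‖k‖ ^ 2)) 1
      rw [← hR' t, ← hξ'] at h
      rw [h]
      simp [stepComb, inner_add_left, inner_smul_left, hk']
  exact h.comp measurable_id (measurable_pi_apply ())

end Decomposition

/-! ### Estimates for the sigmoid and Gaussian densities -/

section Scalar

/-- The likelihood ratio of the two densities is `exp (z - v/2)`, so the sigmoid is the posterior
weight of the class of mean `v`. -/
lemma gaussianPDFReal_eq_sigmoid_mul_add {v : NNReal} (hv : v ≠ 0) (z : ℝ) :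
    gaussianPDFReal v v z = gaussianPDFReal v v z * Real.sigmoid (z - v / 2) +
      gaussianPDFReal 0 v z * Real.sigmoid (z - v / 2) := by
  have hv' : (v : ℝ) ≠ 0 := by exact_mod_cast hv
  have h : gaussianPDFReal 0 v z = gaussianPDFReal v v z * Real.exp (-(z - v / 2)) := by
    rw [gaussianPDFReal, gaussianPDFReal, mul_assoc (_⁻¹), ← Real.exp_add]
    congr 2
    field_simp
    ring
  have h1 : (1 + Real.exp (-(z - v / 2))) ≠ 0 := by positivity
  rw [h, Real.sigmoid_def]
  field_simp

/-- Bayes' formula for two Gaussian classes of variance `v` and means `v` and `0`. -/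
lemma integral_gaussianReal_eq_sigmoid {v : NNReal} (hv : v ≠ 0) {ψ : ℝ → ℝ} (hψ : Measurable ψ)
    (hb : ∀ z, ‖ψ z‖ ≤ 1) :
    ∫ z, ψ (z + v) ∂(gaussianReal 0 v) =
      ∫ z, Real.sigmoid (z + v - v / 2) * ψ (z + v) ∂(gaussianReal 0 v) +
      ∫ z, Real.sigmoid (z - v / 2) * ψ z ∂(gaussianReal 0 v) := by
  have hshift : ∀ F : ℝ → ℝ, Measurable F →
      ∫ z, F (z + v) ∂(gaussianReal 0 v) = ∫ z, F z ∂(gaussianReal v v) := fun F hF => by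
    have := gaussianReal_map_add_const (μ := 0) (v := v) (v : ℝ)
    rw [zero_add] at this
    rw [← this, integral_map (by fun_prop) hF.aestronglyMeasurable]
  have hs : Measurable fun z : ℝ => Real.sigmoid (z - v / 2) * ψ z :=
    ((continuous_sigmoid.measurable).comp (by fun_prop)).mul hψ
  have hsb : ∀ z, ‖Real.sigmoid (z - v / 2) * ψ z‖ ≤ 1 := fun z => by
    rw [norm_mul, Real.norm_of_nonneg (Real.sigmoid_nonneg _)]
    exact mul_le_one₀ (Real.sigmoid_le_one _) (norm_nonneg _) (hb z)
  rw [hshift ψ hψ, hshift (fun z => Real.sigmoid (z - v / 2) * ψ z) hs,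
    integral_gaussianReal_eq_integral_smul hv, integral_gaussianReal_eq_integral_smul hv,
    integral_gaussianReal_eq_integral_smul hv, ← integral_add]
  · refine integral_congr_ae (ae_of_all _ fun z => ?_)
    simp only [smul_eq_mul]
    linear_combination ψ z * gaussianPDFReal_eq_sigmoid_mul_add hv z
  · exact (integrable_gaussianPDFReal _ _).mul_bdd (c := 1) hs.aestronglyMeasurable (ae_of_all _ hsb)
  · exact (integrable_gaussianPDFReal _ _).mul_bdd (c := 1) hs.aestronglyMeasurable (ae_of_all _ hsb)

lemma abs_sigmoid_sub_half_le {x : ℝ} : |Real.sigmoid x - 1 / 2| ≤ |x| / 2 := by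
  wlog hx : 0 ≤ x generalizing x
  · have h := this (x := -x) (by linarith)
    rw [Real.sigmoid_neg, abs_neg] at h
    rwa [abs_sub_comm, show 1 / 2 - Real.sigmoid x = 1 - Real.sigmoid x - 1 / 2 by ring]
  have h1 : 0 < Real.exp (-x) := Real.exp_pos _
  have h2 := Real.add_one_le_exp (-x)
  have h3 : Real.exp (-x) ≤ 1 := Real.exp_le_one_iff.2 (by linarith)
  have h : Real.sigmoid x - 1 / 2 = (1 - Real.exp (-x)) / (2 * (1 + Real.exp (-x))) := by
    rw [Real.sigmoid_def]; field_simp; ring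
  rw [h, abs_of_nonneg (by apply div_nonneg <;> linarith), abs_of_nonneg hx,
    div_le_div_iff₀ (by positivity) (by norm_num)]
  nlinarith

lemma le_abs_sigmoid_sub_half {x : ℝ} (hx1 : |x| ≤ 1 / 4) : |x| / 5 ≤ |Real.sigmoid x - 1 / 2| := by
  wlog hx : 0 ≤ x generalizing x
  · have h := this (x := -x) (by rwa [abs_neg]) (by linarith)
    rw [Real.sigmoid_neg, abs_neg] at h
    rwa [abs_sub_comm, show 1 / 2 - Real.sigmoid x = 1 - Real.sigmoid x - 1 / 2 by ring]
  rw [abs_of_nonneg hx] at *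
  have h1 : 0 < Real.exp (-x) := Real.exp_pos _
  have h3 : Real.exp (-x) ≤ 1 := Real.exp_le_one_iff.2 (by linarith)
  have h2 : Real.exp (-x) * (1 + x) ≤ 1 := by
    have := Real.add_one_le_exp x
    calc _ ≤ Real.exp (-x) * Real.exp x := by gcongr; linarith
      _ = 1 := by rw [← Real.exp_add]; simp
  have h : Real.sigmoid x - 1 / 2 = (1 - Real.exp (-x)) / (2 * (1 + Real.exp (-x))) := by
    rw [Real.sigmoid_def]; field_simp; ring
  rw [h, abs_of_nonneg (by apply div_nonneg <;> linarith),
    div_le_div_iff₀ (by norm_num) (by positivity)]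
  -- `1 - exp (-x) ≥ x / (1 + x)` and `1 + x ≤ 5/4`; the denominator is at most `4`, whence the
  -- factor `1/5`.
  have h4 : 4 / 5 * x ≤ 1 - Real.exp (-x) := by nlinarith
  nlinarith

lemma crownConst_pos (Δ : ℝ) : 0 < crownConst Δ := by unfold crownConst; positivity

lemma crownConst_le {Δ : ℝ} (hΔ : 0 ≤ Δ) : crownConst Δ ≤ 3 / 20 := by
  have h1 : (12 / 5 : ℝ) ≤ Real.sqrt (2 * Real.pi) := by
    apply Real.le_sqrt_of_sq_le; nlinarith [Real.pi_gt_three]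
  have h2 : Real.exp (-(1 + Δ / 2) ^ 2 / 2) ≤ 2 / 3 := by
    have h3 : Real.exp (-(1 + Δ / 2) ^ 2 / 2) ≤ Real.exp (-(1 / 2)) :=
      Real.exp_le_exp.2 (by nlinarith)
    have h4 := Real.add_one_le_exp (1 / 2)
    have h5 : Real.exp (-(1 / 2)) * Real.exp (1 / 2) = 1 := by rw [← Real.exp_add]; simp
    nlinarith [Real.exp_pos (-(1 / 2))]
  unfold crownConst
  rw [div_le_div_iff₀ (by positivity) (by norm_num)]
  nlinarith

/-- The range of `z` is the one on which `z² / (2Δ²) ≤ (1 + Δ/2)² / 2`. It contains every point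
within `ε ≤ Δ` of `±Δ²/2`. -/
lemma crownConst_le_gaussianPDFReal {Δ : ℝ} (hΔ : 0 < Δ) {v : NNReal} (hv : (v : ℝ) = Δ ^ 2)
    {z : ℝ} (hz : |z| ≤ Δ * (1 + Δ / 2)) :
    2 * crownConst Δ / Δ ≤ gaussianPDFReal 0 v z := by
  have h1 : Real.sqrt (2 * Real.pi * v) = Real.sqrt (2 * Real.pi) * Δ := by
    rw [hv, Real.sqrt_mul (by positivity), Real.sqrt_sq hΔ.le]
  rw [gaussianPDFReal, h1, sub_zero, hv, crownConst]
  have h2 : Real.exp (-(1 + Δ / 2) ^ 2 / 2) ≤ Real.exp (-z ^ 2 / (2 * Δ ^ 2)) := by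
    refine Real.exp_le_exp.2 ?_
    rw [div_le_div_iff₀ (by norm_num) (by positivity)]
    have := sq_le_sq' (abs_le.1 hz).1 (abs_le.1 hz).2
    nlinarith
  calc _ = (Real.sqrt (2 * Real.pi) * Δ)⁻¹ * Real.exp (-(1 + Δ / 2) ^ 2 / 2) := by
        field_simp
    _ ≤ _ := by gcongr

lemma crownConst_mul_le_gaussianReal_Icc {Δ : ℝ} (hΔ : 0 < Δ) {v : NNReal}
    (hv : (v : ℝ) = Δ ^ 2) {p q : ℝ} (hpq : p ≤ q) (hp : -(Δ * (1 + Δ / 2)) ≤ p)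
    (hq : q ≤ Δ * (1 + Δ / 2)) :
    2 * crownConst Δ / Δ * (q - p) ≤ (gaussianReal 0 v).real (Set.Icc p q) := by
  have hv0 : v ≠ 0 := by
    rintro rfl
    have := pow_pos hΔ 2
    simp [← hv] at this
  rw [measureReal_def, gaussianReal_apply_eq_integral _ hv0, ENNReal.toReal_ofReal
    (integral_nonneg fun _ => gaussianPDFReal_nonneg _ _ _)]
  calc 2 * crownConst Δ / Δ * (q - p) = ∫ _ in Set.Icc p q, 2 * crownConst Δ / Δ := by
        simp [hpq, mul_comm]
    _ ≤ _ := by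
        refine setIntegral_mono_on (by simp) (integrable_gaussianPDFReal _ _).integrableOn
          measurableSet_Icc fun z hz => crownConst_le_gaussianPDFReal hΔ hv (abs_le.2 ⟨?_, ?_⟩)
        · exact hp.trans hz.1
        · exact hz.2.trans hq

lemma crownConst_mul_le_gaussianReal {Δ : ℝ} (hΔ : 0 < Δ) {v : NNReal}
    (hv : (v : ℝ) = Δ ^ 2) {ε c : ℝ} (hε : 0 < ε) (hεΔ : ε ≤ Δ) (hc : |c| = Δ ^ 2 / 2) :
    crownConst Δ * (ε / Δ) ≤
      (gaussianReal 0 v).real {z | 5 * crownConst Δ * ε ≤ |z + c| ∧ |z + c| ≤ ε} := by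
  have hδ := crownConst_pos Δ
  have hδ' := crownConst_le hΔ.le
  have hc1 := abs_le.1 hc.le
  have ha : 0 < 5 * crownConst Δ * ε := by positivity
  have hae : 5 * crownConst Δ * ε ≤ 3 / 4 * ε := by nlinarith
  have h1 := crownConst_mul_le_gaussianReal_Icc hΔ hv (p := -c + 5 * crownConst Δ * ε)
    (q := -c + ε) (by linarith) (by nlinarith) (by nlinarith)
  have h2 := crownConst_mul_le_gaussianReal_Icc hΔ hv (p := -c - ε)
    (q := -c - 5 * crownConst Δ * ε) (by linarith) (by nlinarith) (by nlinarith)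
  have hsub : Set.Icc (-c + 5 * crownConst Δ * ε) (-c + ε) ∪
      Set.Icc (-c - ε) (-c - 5 * crownConst Δ * ε) ⊆
      {z | 5 * crownConst Δ * ε ≤ |z + c| ∧ |z + c| ≤ ε} := by
    rintro z (hz | hz)
    · have : |z + c| = z + c := abs_of_nonneg (by linarith [hz.1])
      exact ⟨by linarith [hz.1], by linarith [hz.2]⟩
    · have : |z + c| = -(z + c) := abs_of_nonpos (by linarith [hz.2])
      exact ⟨by linarith [hz.2], by linarith [hz.1]⟩
  have hdisj : Disjoint (Set.Icc (-c + 5 * crownConst Δ * ε) (-c + ε))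
      (Set.Icc (-c - ε) (-c - 5 * crownConst Δ * ε)) :=
    Set.disjoint_left.2 fun z hz hz' => by linarith [hz.1, hz'.2]
  refine le_trans ?_ (measureReal_mono hsub)
  rw [measureReal_union hdisj measurableSet_Icc]
  refine le_trans ?_ (add_le_add h1 h2)
  have h3 : 0 < crownConst Δ / Δ := by positivity
  calc crownConst Δ * (ε / Δ) = crownConst Δ / Δ * ε := by ring
    -- `4 (1 - 5δ) ≥ 1`, from `5δ ≤ 3/4`.
    _ ≤ crownConst Δ / Δ * (4 * (ε - 5 * crownConst Δ * ε)) := by gcongr; linarith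
    _ = _ := by ring

end Scalar

/-! ### Bayes' formula and the two-class mixture -/

section Bayes

lemma integral_prod_bernoulliMeasure_half {E : Type*} [MeasurableSpace E] {Q : Measure E}
    [IsProbabilityMeasure Q] {Φ : E × ℝ → ℝ} (hΦ : Measurable Φ)
    (hb : ∀ q y, ‖Φ (q, y)‖ ≤ ‖y‖ + 1) :
    ∫ x, Φ x ∂(Q.prod (bernoulliMeasure (1 : ℝ) 0 ⟨1 / 2, by norm_num, by norm_num⟩)) =
      1 / 2 * ∫ q, Φ (q, 1) ∂Q + 1 / 2 * ∫ q, Φ (q, 0) ∂Q := by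
  have hint : Integrable Φ
      (Q.prod (bernoulliMeasure (1 : ℝ) 0 ⟨1 / 2, by norm_num, by norm_num⟩)) := by
    refine Integrable.mono' (g := fun x => ‖x.2‖ + 1) ?_ hΦ.aestronglyMeasurable
      (ae_of_all _ fun x => hb x.1 x.2)
    exact Integrable.comp_snd (f := fun y : ℝ => ‖y‖ + 1) (integrable_bernoulliMeasure _ _ _ _) Q
  rw [integral_prod_symm _ hint, integral_bernoulliMeasure]
  norm_num

variable {Ω E F : Type*} [MeasurableSpace Ω] [MeasurableSpace E] [MeasurableSpace F]
  {P : Measure Ω} [IsProbabilityMeasure P]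

/-- The regression function in a two-class problem where the input is a function of an
uninformative variable `R` and of a Gaussian variable of mean `v * Y` and variance `v`. -/
lemma condExp_label_eq_sigmoid {R : Ω → E} {ξ Y : Ω → ℝ} {X : Ω → F} {Ψ : E → ℝ → F} {v : NNReal}
    (hv : v ≠ 0) (hR : Measurable R) (hξ : Measurable ξ) (hY : Measurable Y) (hX : Measurable X)
    (hΨ : Measurable fun p : E × ℝ => Ψ p.1 p.2)
    (hξlaw : P.map ξ = gaussianReal 0 v)
    (hYlaw : P.map Y = bernoulliMeasure (1 : ℝ) 0 ⟨1 / 2, by norm_num, by norm_num⟩)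
    (hRξ : IndepFun R ξ P) (hRξY : IndepFun (fun ω => (R ω, ξ ω)) Y P)
    (hXΨ : ∀ᵐ ω ∂P, X ω = Ψ (R ω) (ξ ω + Y ω * v))
    (hmeas : AEStronglyMeasurable[MeasurableSpace.comap X inferInstance]
      (fun ω => ξ ω + Y ω * v) P) :
    P[Y | MeasurableSpace.comap X inferInstance] =ᵐ[P]
      fun ω => Real.sigmoid (ξ ω + Y ω * v - v / 2) := by
  have hρ : IsProbabilityMeasure (P.map R) := Measure.isProbabilityMeasure_map hR.aemeasurable
  have hlaw : P.map (fun ω => ((R ω, ξ ω), Y ω)) = ((P.map R).prod (gaussianReal 0 v)).prod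
      (bernoulliMeasure (1 : ℝ) 0 ⟨1 / 2, by norm_num, by norm_num⟩) := by
    rw [(indepFun_iff_map_prod_eq_prod_map_map (hR.prodMk hξ).aemeasurable
      hY.aemeasurable).1 hRξY, (indepFun_iff_map_prod_eq_prod_map_map hR.aemeasurable
      hξ.aemeasurable).1 hRξ, hξlaw, hYlaw]
  have hYint : Integrable Y P := by
    have : Integrable id (P.map Y) := by
      rw [hYlaw]; exact integrable_bernoulliMeasure _ _ _ _
    exact (integrable_map_measure (by fun_prop) hY.aemeasurable).1 this
  have hsig : Measurable Real.sigmoid := continuous_sigmoid.measurable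
  have hηint : Integrable (fun ω => Real.sigmoid (ξ ω + Y ω * v - v / 2)) P := by
    refine Integrable.of_bound (hsig.comp (by fun_prop)).aestronglyMeasurable 1
      (ae_of_all _ fun ω => ?_)
    rw [Real.norm_of_nonneg (Real.sigmoid_nonneg _)]
    exact Real.sigmoid_le_one _
  have hsm : AEStronglyMeasurable[MeasurableSpace.comap X inferInstance]
      (fun ω => Real.sigmoid (ξ ω + Y ω * v - v / 2)) P :=
    (continuous_sigmoid.comp (continuous_id.sub continuous_const)).comp_aestronglyMeasurable hmeas
  -- It remains to test on events `X ⁻¹' B`. There both sides become integrals over the product law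
  -- of `R`, `ξ`, `Y`, and Bayes' formula applies for each fixed value of `R`.
  refine (ae_eq_condExp_of_forall_setIntegral_eq hX.comap_le hYint
    (fun s _ _ => hηint.integrableOn) ?_ hsm).symm
  rintro _ ⟨B, hB, rfl⟩ -
  set χ : F → ℝ := B.indicator 1 with hχ
  have hχm : Measurable χ := measurable_one.indicator hB
  have hχ0 : ∀ x, 0 ≤ χ x := fun x => Set.indicator_nonneg (fun _ _ => zero_le_one) x
  have hχ1 : ∀ x, χ x ≤ 1 := fun x => Set.indicator_le_self' (fun _ _ => zero_le_one) x
  have hχb : ∀ x, ‖χ x‖ ≤ 1 := fun x => by rw [Real.norm_of_nonneg (hχ0 x)]; exact hχ1 x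
  have hset : ∀ Z : Ω → ℝ, ∫ ω in X ⁻¹' B, Z ω ∂P =
      ∫ ω, Z ω * χ (Ψ (R ω) (ξ ω + Y ω * v)) ∂P := fun Z => by
    rw [← integral_indicator (hX hB)]
    refine integral_congr_ae ?_
    filter_upwards [hXΨ] with ω hω
    rw [← hω]
    by_cases h : X ω ∈ B <;> simp [hχ, h]
  have htriple : Measurable fun ω => ((R ω, ξ ω), Y ω) := (hR.prodMk hξ).prodMk hY
  have hχΨ : ∀ {T : Type _} [MeasurableSpace T] {a : T → E} {b : T → ℝ}, Measurable a →
      Measurable b → Measurable fun t => χ (Ψ (a t) (b t)) := fun ha hb =>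
    hχm.comp (hΨ.comp (ha.prodMk hb))
  have hm1 : Measurable fun x : (E × ℝ) × ℝ => x.2 * χ (Ψ x.1.1 (x.1.2 + x.2 * v)) :=
    measurable_snd.mul (hχΨ (by fun_prop) (by fun_prop))
  have hm2 : Measurable fun x : (E × ℝ) × ℝ =>
      Real.sigmoid (x.1.2 + x.2 * v - v / 2) * χ (Ψ x.1.1 (x.1.2 + x.2 * v)) :=
    (hsig.comp (by fun_prop)).mul (hχΨ (by fun_prop) (by fun_prop))
  have hsb : ∀ u x, ‖Real.sigmoid u * χ x‖ ≤ 1 := fun u x => by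
    rw [norm_mul, Real.norm_of_nonneg (Real.sigmoid_nonneg _)]
    exact mul_le_one₀ (Real.sigmoid_le_one _) (norm_nonneg _) (hχb x)
  have e1 : ∫ ω, Y ω * χ (Ψ (R ω) (ξ ω + Y ω * v)) ∂P =
      1 / 2 * ∫ q, χ (Ψ q.1 (q.2 + v)) ∂((P.map R).prod (gaussianReal 0 v)) := by
    have := integral_map htriple.aemeasurable (μ := P) hm1.aestronglyMeasurable
    rw [← this, hlaw, integral_prod_bernoulliMeasure_half hm1]
    · simp
    · intro q y
      rw [norm_mul]
      nlinarith [norm_nonneg y, hχb (Ψ q.1 (q.2 + y * v))]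
  have e2 : ∫ ω, Real.sigmoid (ξ ω + Y ω * v - v / 2) * χ (Ψ (R ω) (ξ ω + Y ω * v)) ∂P =
      1 / 2 * ∫ q, Real.sigmoid (q.2 + v - v / 2) * χ (Ψ q.1 (q.2 + v))
        ∂((P.map R).prod (gaussianReal 0 v)) +
      1 / 2 * ∫ q, Real.sigmoid (q.2 - v / 2) * χ (Ψ q.1 q.2)
        ∂((P.map R).prod (gaussianReal 0 v)) := by
    have := integral_map htriple.aemeasurable (μ := P) hm2.aestronglyMeasurable
    rw [← this, hlaw, integral_prod_bernoulliMeasure_half hm2]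
    · simp
    · intro q y
      exact (hsb _ _).trans (by linarith [norm_nonneg y])
  have i1 : Integrable (fun q : E × ℝ => χ (Ψ q.1 (q.2 + v)))
      ((P.map R).prod (gaussianReal 0 v)) :=
    Integrable.of_bound (hχΨ (by fun_prop) (by fun_prop)).aestronglyMeasurable 1
      (ae_of_all _ fun _ => hχb _)
  have i2 : Integrable (fun q : E × ℝ => Real.sigmoid (q.2 + v - v / 2) * χ (Ψ q.1 (q.2 + v)))
      ((P.map R).prod (gaussianReal 0 v)) :=
    Integrable.of_bound ((hsig.comp (by fun_prop)).mul
      (hχΨ (by fun_prop) (by fun_prop))).aestronglyMeasurable 1 (ae_of_all _ fun _ => hsb _ _)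
  have i3 : Integrable (fun q : E × ℝ => Real.sigmoid (q.2 - v / 2) * χ (Ψ q.1 q.2))
      ((P.map R).prod (gaussianReal 0 v)) :=
    Integrable.of_bound ((hsig.comp (by fun_prop)).mul
      (hχΨ (by fun_prop) (by fun_prop))).aestronglyMeasurable 1 (ae_of_all _ fun _ => hsb _ _)
  rw [hset, hset, e1, e2, ← mul_add, integral_prod _ i1, integral_prod _ i2, integral_prod _ i3,
    ← integral_add i2.integral_prod_left i3.integral_prod_left]
  congr 1
  refine integral_congr_ae (ae_of_all _ fun r => ?_)
  exact (integral_gaussianReal_eq_sigmoid hv (ψ := fun u => χ (Ψ r u))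
    (hχm.comp (hΨ.comp measurable_prodMk_left)) fun _ => hχb _).symm

/-- Conditionally on `Y = 1` or `Y = 0` the variable is `ξ` shifted by `Δ²/2` or `-Δ²/2`; both
shifts satisfy the same bound, so their average does. -/
lemma le_measureReal_abs_sub_half {ξ Y : Ω → ℝ} {v : NNReal} {Δ ε : ℝ} (hΔ : 0 < Δ)
    (hv : (v : ℝ) = Δ ^ 2) (hε : 0 < ε) (hεΔ : ε ≤ Δ) (hξ : Measurable ξ) (hY : Measurable Y)
    (hξlaw : P.map ξ = gaussianReal 0 v)
    (hYlaw : P.map Y = bernoulliMeasure (1 : ℝ) 0 ⟨1 / 2, by norm_num, by norm_num⟩)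
    (hξY : IndepFun ξ Y P) :
    crownConst Δ * (ε / Δ) ≤ P.real {ω | 5 * crownConst Δ * ε ≤ |ξ ω + Y ω * v - v / 2| ∧
      |ξ ω + Y ω * v - v / 2| ≤ ε} := by
  set A : Set (ℝ × ℝ) := {x | 5 * crownConst Δ * ε ≤ |x.1 + x.2 * v - v / 2| ∧
      |x.1 + x.2 * v - v / 2| ≤ ε} with hA
  have hm : Measurable fun x : ℝ × ℝ => |x.1 + x.2 * v - v / 2| := by fun_prop
  have hAm : MeasurableSet A :=
    (measurableSet_le measurable_const hm).inter (measurableSet_le hm measurable_const)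
  have hlaw : P.map (fun ω => (ξ ω, Y ω)) = (gaussianReal 0 v).prod
      (bernoulliMeasure (1 : ℝ) 0 ⟨1 / 2, by norm_num, by norm_num⟩) := by
    rw [(indepFun_iff_map_prod_eq_prod_map_map hξ.aemeasurable hY.aemeasurable).1 hξY, hξlaw,
      hYlaw]
  have h1 : P.real {ω | 5 * crownConst Δ * ε ≤ |ξ ω + Y ω * v - v / 2| ∧
      |ξ ω + Y ω * v - v / 2| ≤ ε} = (P.map (fun ω => (ξ ω, Y ω))).real A := by
    rw [map_measureReal_apply (hξ.prodMk hY) hAm]; rfl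
  have hsec : ∀ y : ℝ, ∫ z, A.indicator (1 : ℝ × ℝ → ℝ) (z, y) ∂(gaussianReal 0 v) =
      (gaussianReal 0 v).real ((fun z => (z, y)) ⁻¹' A) := fun y => by
    have hm : Measurable fun z : ℝ => (z, y) := by fun_prop
    rw [← integral_indicator_one (hm hAm)]
    rfl
  rw [h1, hlaw, ← integral_indicator_one hAm,
    integral_prod_bernoulliMeasure_half (measurable_one.indicator hAm), hsec, hsec]
  · have b1 := crownConst_mul_le_gaussianReal hΔ hv hε hεΔ (c := Δ ^ 2 / 2)
      (abs_of_nonneg (by positivity))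
    have b2 := crownConst_mul_le_gaussianReal hΔ hv hε hεΔ (c := -(Δ ^ 2 / 2))
      (by rw [abs_neg]; exact abs_of_nonneg (by positivity))
    have s1 : (fun z : ℝ => (z, (1 : ℝ))) ⁻¹' A =
        {z | 5 * crownConst Δ * ε ≤ |z + Δ ^ 2 / 2| ∧ |z + Δ ^ 2 / 2| ≤ ε} := by
      ext z
      simp only [hA, Set.mem_preimage, Set.mem_ofPred_eq]
      rw [show z + 1 * v - v / 2 = z + Δ ^ 2 / 2 by rw [hv]; ring]
    have s0 : (fun z : ℝ => (z, (0 : ℝ))) ⁻¹' A =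
        {z | 5 * crownConst Δ * ε ≤ |z + -(Δ ^ 2 / 2)| ∧ |z + -(Δ ^ 2 / 2)| ≤ ε} := by
      ext z
      simp only [hA, Set.mem_preimage, Set.mem_ofPred_eq]
      rw [show z + 0 * v - v / 2 = z + -(Δ ^ 2 / 2) by rw [hv]; ring]
    rw [s1, s0]
    linarith
  · intro q y
    have : ‖A.indicator (1 : ℝ × ℝ → ℝ) (q, y)‖ ≤ 1 := by
      by_cases h : (q, y) ∈ A <;> simp [h]
    linarith [norm_nonneg y]

end Bayes

/-! ### The regression function of the model and the conclusion -/

lemma norm_toLp_sub_eq_l2Dist {f g : ℝ → ℝ}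
    (h : MemLp (f - g) 2 (volume.restrict (Set.Icc (0 : ℝ) 1))) :
    ‖h.toLp‖ = l2Dist f g := by
  rw [norm_eq_sqrt_real_inner, L2.inner_def, l2Dist, intervalIntegral.integral_of_le zero_le_one,
    ← integral_Icc_eq_integral_Ioc]
  congr 1
  refine integral_congr_ae ?_
  filter_upwards [h.coeFn_toLp] with x hx
  simp [hx, sq]

lemma inner_stepLp_toLp_sub {f g : ℝ → ℝ}
    (hf : MemLp f 2 (volume.restrict (Set.Icc (0 : ℝ) 1)))
    (hg : MemLp g 2 (volume.restrict (Set.Icc (0 : ℝ) 1))) (t : I) :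
    inner ℝ (stepLp t) (hf.sub hg).toLp = (∫ s in (0 : ℝ)..t, f s) - ∫ s in (0 : ℝ)..t, g s := by
  have hi : ∀ {k : ℝ → ℝ}, MemLp k 2 (volume.restrict (Set.Icc (0 : ℝ) 1)) →
      IntegrableOn k (Set.Iic (t : ℝ)) (volume.restrict (Set.Icc (0 : ℝ) 1)) := fun hk =>
    (hk.integrable (by norm_num)).integrableOn
  rw [stepLp, L2.inner_indicatorConstLp_one, ← setIntegral_Iic_restrict_Icc,
    ← setIntegral_Iic_restrict_Icc, ← integral_sub (hi hf) (hi hg)]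
  refine setIntegral_congr_ae measurableSet_Iic ?_
  filter_upwards [(hf.sub hg).coeFn_toLp] with x hx _
  rw [hx]; rfl

open Filter Topology in
lemma etaX_ae_eq_sigmoid {Ω : Type*} [MeasurableSpace Ω] {P : Measure Ω} [IsProbabilityMeasure P]
    {f g : ℝ → ℝ} (hf : MemLp f 2 (volume.restrict (Set.Icc (0 : ℝ) 1)))
    (hg : MemLp g 2 (volume.restrict (Set.Icc (0 : ℝ) 1)))
    {X : I → Ω → ℝ} {Y : Ω → ℝ} {W : I → Ω → ℝ} (hmodel : IsFunctionalModel f g X Y W P)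
    (hfg : 0 < l2Dist f g) :
    ∃ (ξ : Ω → ℝ) (v : NNReal), (v : ℝ) = l2Dist f g ^ 2 ∧ Measurable ξ ∧
      P.map ξ = gaussianReal 0 v ∧ IndepFun ξ Y P ∧
      etaX X Y P =ᵐ[P] fun ω => Real.sigmoid (ξ ω + Y ω * v - v / 2) := by
  set k := (hf.sub hg).toLp with hkdef
  have hkn : ‖k‖ = l2Dist f g := norm_toLp_sub_eq_l2Dist _
  have hk : k ≠ 0 := norm_pos_iff.1 (hkn ▸ hfg)
  have hWm := hmodel.brownian.measurable
  obtain ⟨c, ξ, hξW, hck, hcξ, hlaw⟩ := hmodel.brownian.exists_wienerIntegral k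
  have hWpi : Measurable fun ω t => W t ω := measurable_pi_lambda _ hWm
  have hξ : Measurable ξ := hξW.mono hWpi.comap_le le_rfl
  have hξlaw : P.map ξ = gaussianReal 0 (‖k‖₊ ^ 2) := by simpa using hlaw 0 1
  set R : Ω → I → ℝ := fun ω t => W t ω - inner ℝ (stepLp t) k / ‖k‖ ^ 2 * ξ ω with hR
  have hRm : Measurable R := measurable_pi_lambda _ fun t => (hWm t).sub (hξ.const_mul _)
  have hRξ : IndepFun R ξ P := indepFun_residual hk hWm hξ hlaw
  have hRξY : IndepFun (fun ω => (R ω, ξ ω)) Y P := by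
    -- As `ξ` is a measurable function of the path of `W`, so is `(R, ξ)`, and independence from `Y`
    -- is inherited.
    obtain ⟨ξ', hξ', rfl⟩ := hξW.exists_eq_measurable_comp
    have hΘ : Measurable fun w : I → ℝ =>
        ((fun t => w t - inner ℝ (stepLp t) k / ‖k‖ ^ 2 * ξ' w : I → ℝ), ξ' w) :=
      (measurable_pi_lambda _ fun t => (measurable_pi_apply t).sub (hξ'.const_mul _)).prodMk hξ'
    exact (hmodel.indep.comp measurable_id hΘ).symm
  have hk0 : ‖k‖ ^ 2 ≠ 0 := pow_ne_zero _ (norm_ne_zero_iff.2 hk)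
  have hXpi : Measurable fun ω t => X t ω := measurable_pi_lambda _ hmodel.measurable_input
  set G : I → ℝ := fun t => ∫ s in (0 : ℝ)..t, g s
  have hX : ∀ᵐ ω ∂P, ∀ t, X t ω = G t + Y ω * inner ℝ (stepLp t) k + W t ω := by
    filter_upwards [hmodel.solution] with ω hω t
    rw [hω t, hkdef, inner_stepLp_toLp_sub hf hg]
    ring
  have hη := condExp_label_eq_sigmoid (v := ‖k‖₊ ^ 2) (X := fun ω t => X t ω)
    (Ψ := fun (r : I → ℝ) u t => G t + r t + inner ℝ (stepLp t) k / ‖k‖ ^ 2 * u)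
    (pow_ne_zero _ (nnnorm_ne_zero_iff.2 hk)) hRm hξ hmodel.measurable_label hXpi
    (measurable_pi_lambda _ fun t =>
      (((measurable_pi_apply t).comp measurable_fst).const_add _).add (measurable_snd.const_mul _))
    hξlaw hmodel.label_law.map_eq hRξ hRξY ?_ ?_
  · exact ⟨ξ, ‖k‖₊ ^ 2, by simp [hkn], hξ, hξlaw,
      hRξY.comp measurable_snd measurable_id, hη⟩
  · filter_upwards [hX] with ω hω
    funext t
    rw [hω t]
    simp only [hR, NNReal.coe_pow, coe_nnnorm]
    field_simp
    ring
  -- `U` is measurable in `X` up to a null set: the combinations approximating `ξ`, applied to `X -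
  -- G`, converge to `ξ + Y ‖k‖²` because the inner products of their step functions with `k` tend
  -- to `‖k‖²`.
  · obtain ⟨ζ, hζm, hζ⟩ := exists_measurable_forall_tendsto_eq
      (m := MeasurableSpace.comap (fun ω t => X t ω) MeasurableSpace.pi)
      fun n => measurable_processComb (W := fun t ω => X t ω - G t)
        (fun t => Measurable.sub_const (f := X t)
          ((measurable_pi_apply t).comp (comap_measurable fun ω t => X t ω)) (G t)) (c n)
    refine ⟨ζ, hζm.stronglyMeasurable, ?_⟩
    filter_upwards [hX, hcξ] with ω h1 h2
    refine hζ ω _ ?_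
    have h3 : ∀ n, processComb (fun t ω => X t ω - G t) (c n) ω =
        processComb W (c n) ω + Y ω * inner ℝ (stepComb (c n)) k := fun n => by
      rw [processComb_apply, processComb_apply, stepComb, Finsupp.linearCombination_apply,
        Finsupp.sum, sum_inner, Finset.mul_sum, ← Finset.sum_add_distrib]
      refine Finset.sum_congr rfl fun t _ => ?_
      rw [h1, real_inner_smul_left]
      ring
    simp_rw [h3]
    have h4 : Tendsto (fun n => inner ℝ (stepComb (c n)) k) atTop (𝓝 (inner ℝ k k)) :=
      hck.inner tendsto_const_nhds
    rw [real_inner_self_eq_norm_sq] at h4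
    simpa using h2.add (h4.const_mul (Y ω))

theorem proposition6 {Ω : Type*} [MeasurableSpace Ω] (P : Measure Ω) [IsProbabilityMeasure P]
    (f g : ℝ → ℝ)
    (hf : MemLp f 2 (volume.restrict (Set.Icc (0 : ℝ) 1)))
    (hg : MemLp g 2 (volume.restrict (Set.Icc (0 : ℝ) 1)))
    (X : I → Ω → ℝ) (Y : Ω → ℝ) (W : I → Ω → ℝ)
    (hmodel : IsFunctionalModel f g X Y W P)
    (hfg : 0 < l2Dist f g)
    (ε : ℝ) (hε : ε ≤ min (1 / 4) (l2Dist f g)) :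
    crownConst (l2Dist f g) * (ε / l2Dist f g) ≤
      P.real {ω | crownConst (l2Dist f g) * ε ≤ |etaX X Y P ω - 1 / 2| ∧
        |etaX X Y P ω - 1 / 2| ≤ ε} := by
  have hδ := crownConst_pos (l2Dist f g)
  -- No positivity of `ε` is assumed; for `ε ≤ 0` the lower bound is nonpositive.
  rcases le_or_gt ε 0 with hε0 | hε0
  · exact (mul_nonpos_of_nonneg_of_nonpos hδ.le
      (div_nonpos_of_nonpos_of_nonneg hε0 hfg.le)).trans measureReal_nonneg
  obtain ⟨ξ, v, hv, hξ, hξlaw, hξY, hη⟩ := etaX_ae_eq_sigmoid hf hg hmodel hfg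
  refine (le_measureReal_abs_sub_half hfg hv hε0 (hε.trans (min_le_right _ _)) hξ
    hmodel.measurable_label hξlaw hmodel.label_law.map_eq hξY).trans ?_
  refine ENNReal.toReal_mono (measure_ne_top _ _) (measure_mono_ae ?_)
  filter_upwards [hη] with ω hω h
  obtain ⟨h1, h2⟩ : _ ∧ _ := h
  have hL := h2.trans (hε.trans (min_le_left _ _))
  refine ⟨?_, ?_⟩
  · rw [hω]
    linarith [le_abs_sigmoid_sub_half hL]
  · rw [hω]
    linarith [abs_sigmoid_sub_half_le (x := ξ ω + Y ω * v - v / 2)]
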